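/- For a Tychonoff space $X$ and a compact subset $K\subseteq X$, let $\operatorname{Homeo}_K(X)$ be the group of homeomorphisms of $X$ that are the identity on $X\setminus K$, equipped with the compact-open topology, and let $\operatorname{Homeo}_{cpt}(X)=\bigcup_K \operatorname{Homeo}_K(X)$, the union being over all compact $K\subseteq X$. The space $X$ is said to have the Compactly Supported Homeomorphism Property (CSHP) if the following two topologies on $\operatorname{Homeo}_{cpt}(X)$ coincide: the finest topology making all inclusions $\operatorname{Homeo}_K(X)\to\operatorname{Homeo}_{cpt}(X)$ continuous, and the topology induced by the homeomorphism group $\operatorname{Homeo}(\beta X)$ of the Stone–Čech compactification of $X$ with the compact-open topology, each $h\in\operatorname{Homeo}_{cpt}(X)$ being identified with its unique extension $\beta h\in\operatorname{Homeo}(\beta X)$. Theorem. Let $\lambda$ be an infinite limit ordinal, and let $X$ be $\lambda$ equipped with the order topology. If the space $X$ has CSHP, then $\lambda$ is an uncountable regular cardinal. -/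

import Mathlib

/-- The compact-open topology on the set of self-homeomorphisms of `X`, i.e. the topology it
inherits as a subset of the space `C(X, X)` of continuous maps with the compact-open topology. -/
@[reducible]
def homeoCompactOpen (X : Type*) [TopologicalSpace X] : TopologicalSpace (X ≃ₜ X) :=
  TopologicalSpace.induced (fun h => (⟨h, h.continuous⟩ : C(X, X))) ContinuousMap.compactOpen

/-- The homeomorphism `βh` of the Stone-Čech compactification `βX` extending the
homeomorphism `h` of `X`. -/
noncomputable def stoneCechHomeo {X : Type*} [TopologicalSpace X] (h : X ≃ₜ X) :
    StoneCech X ≃ₜ StoneCech X where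
  toFun := stoneCechExtend (continuous_stoneCechUnit.comp h.continuous)
  invFun := stoneCechExtend (continuous_stoneCechUnit.comp h.symm.continuous)
  left_inv := by
    refine congrFun (stoneCech_hom_ext
      ((continuous_stoneCechExtend _).comp (continuous_stoneCechExtend _)) continuous_id ?_)
    ext x
    simp
  right_inv := by
    refine congrFun (stoneCech_hom_ext
      ((continuous_stoneCechExtend _).comp (continuous_stoneCechExtend _)) continuous_id ?_)
    ext x
    simp
  continuous_toFun := continuous_stoneCechExtend _
  continuous_invFun := continuous_stoneCechExtend _

/-- `Homeo_K(X)`: the homeomorphisms of `X` supported in `K`, i.e. equal to the identity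
outside `K`. -/
abbrev HomeoSupp (X : Type*) [TopologicalSpace X] (K : Set X) : Type _ :=
  {h : X ≃ₜ X // ∀ x ∉ K, h x = x}

/-- The compact-open topology on `Homeo_K(X)`. -/
@[reducible]
def homeoSuppCompactOpen (X : Type*) [TopologicalSpace X] (K : Set X) :
    TopologicalSpace (HomeoSupp X K) :=
  TopologicalSpace.induced Subtype.val (homeoCompactOpen X)

/-- `Homeo_cpt(X)`: the compactly supported homeomorphisms of `X`, the union of the sets
`Homeo_K(X)` over all compact `K ⊆ X`. It is given no topology instance, since two topologies
on it are compared below. -/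
abbrev HomeoCpt (X : Type*) [TopologicalSpace X] : Type _ :=
  {h : X ≃ₜ X // ∃ K : Set X, IsCompact K ∧ ∀ x ∉ K, h x = x}

/-- The inclusion of `Homeo_K(X)` into `Homeo_cpt(X)` for compact `K`. -/
def HomeoSupp.incl {X : Type*} [TopologicalSpace X] {K : Set X} (hK : IsCompact K)
    (h : HomeoSupp X K) : HomeoCpt X :=
  ⟨h.1, K, hK, h.2⟩

/-- The colimit topology on `Homeo_cpt(X)`: the finest topology making all the inclusions
`Homeo_K(X) → Homeo_cpt(X)`, `K` compact, continuous. (In the order on topologies used here a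
finer topology is a smaller one, so the finest such topology is the supremum of the
coinduced ones.) -/
@[reducible]
def homeoCptColimit (X : Type*) [TopologicalSpace X] : TopologicalSpace (HomeoCpt X) :=
  ⨆ (K : Set X) (hK : IsCompact K),
    TopologicalSpace.coinduced (HomeoSupp.incl hK) (homeoSuppCompactOpen X K)

/-- The topology on `Homeo_cpt(X)` induced by `Homeo(βX)` with the compact-open topology,
along `h ↦ βh`. -/
@[reducible]
noncomputable def homeoCptBeta (X : Type*) [TopologicalSpace X] : TopologicalSpace (HomeoCpt X) :=
  TopologicalSpace.induced (fun h => stoneCechHomeo h.1) (homeoCompactOpen (StoneCech X))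

/-- The Compactly Supported Homeomorphism Property of a (Tychonoff) space `X`: the colimit
topology on `Homeo_cpt(X)` coincides with the one induced by `Homeo(βX)`. -/
def HasCSHP (X : Type*) [TopologicalSpace X] : Prop :=
  homeoCptColimit X = homeoCptBeta X

/-- The topology that the set of ordinals below `lam` inherits from the ordinals is its own order
topology. -/
theorem orderTopology_Iio_ordinal (lam : Ordinal) : OrderTopology (Set.Iio lam) :=
  inferInstance

/-! Contrapositive: suppose the initial ordinal κ of the cofinality is ω, or is uncountable and
below `lam`. Some family of compactly supported homeomorphisms, none of them the identity, is closed
in the colimit topology but has the identity in its closure in the topology from Homeo(βX).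

Take an increasing cofinal κ-sequence c and, for a < b < κ, swap the isolated points c a + 1 and c b
+ 1. As βX is totally bounded, the pigeonhole principle makes some of these swaps uniformly close to
the identity. A compact support forces b < d for some d < κ. If κ = ω, finitely many pairs remain,
and finite sets are closed.

If κ is uncountable, each swap is also composed with a map labelling its pair: with e = ω ^ b + a,
it sends ω ^ d + 1 to ω ^ d + e + 2 whenever e < ω ^ d < κ. The value at one isolated point then
determines the pair, so the part of the family in each Homeo_K is closed. The labels move only
points between e ≥ a and κ; since κ is a point of X, they tend to the identity as a grows.
`not_hasCSHP_of_isCofinal` treats both cases together. -/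

open Set Filter Topology Uniformity Ordinal

/-! ### Homeomorphisms moving isolated points -/

/-- A self-map of a linear order which preserves the fibres of a monotone map, moves finitely many
points of each fibre and moves only isolated points is continuous. -/
theorem continuous_of_finite_moved_of_monotone {L Q : Type*} [LinearOrder L] [TopologicalSpace L]
    [OrderTopology L] [PartialOrder Q] {q : L → Q} (hq : Monotone q) {f : L → L}
    (hqf : ∀ x, q (f x) = q x) (hfin : ∀ k, {y | q y = k ∧ f y ≠ y}.Finite)
    (hopen : ∀ x, f x ≠ x → IsOpen {x}) : Continuous f := by
  refine continuous_iff_continuousAt.2 fun x => ?_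
  by_cases hx : f x = x
  · have key : ∀ k, ∀ᶠ y in 𝓝 x, y ∉ {y | q y = k ∧ f y ≠ y} := fun k =>
      (hfin k).isClosed.isOpen_compl.mem_nhds fun h => h.2 hx
    rw [ContinuousAt, hx, tendsto_order]
    constructor
    · intro a ha
      -- If f y ≤ a < y, monotonicity squeezes q y to q a, so y is one of the finitely many moved
      -- points in the fibre of a, which avoid a neighbourhood of x.
      filter_upwards [key (q a), lt_mem_nhds ha] with y hy hay
      by_contra! hle
      refine hy ⟨le_antisymm ?_ (hq hay.le), (hle.trans_lt hay).ne⟩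
      rw [← hqf y]
      exact hq hle
    · intro b hb
      filter_upwards [key (q b), gt_mem_nhds hb] with y hy hyb
      by_contra! hle
      refine hy ⟨le_antisymm (hq hyb.le) ?_, (hyb.trans_le hle).ne'⟩
      rw [← hqf y]
      exact hq hle
  · rw [ContinuousAt, (isOpen_singleton_iff_nhds_eq_pure x).1 (hopen x hx)]
    exact (tendsto_pure_nhds f x)

/-- The transposition of two isolated points of a linear order, as a homeomorphism. -/
def swapHomeo {L : Type*} [LinearOrder L] [TopologicalSpace L] [OrderTopology L] {s t : L}
    (hs : IsOpen {s}) (ht : IsOpen {t}) : L ≃ₜ L :=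
  have hc : Continuous (Equiv.swap s t) := by
    refine continuous_of_finite_moved_of_monotone (q := fun _ => ()) (fun _ _ _ => le_rfl)
      (fun _ => rfl) (fun _ => (Set.toFinite {s, t}).subset ?_) ?_
    · rintro y ⟨-, hy⟩
      by_contra h
      simp only [mem_insert_iff, mem_singleton_iff, not_or] at h
      exact hy (Equiv.swap_apply_of_ne_of_ne h.1 h.2)
    · intro y hy
      by_cases h1 : y = s
      · exact h1 ▸ hs
      by_cases h2 : y = t
      · exact h2 ▸ ht
      exact absurd (Equiv.swap_apply_of_ne_of_ne h1 h2) hy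
  { Equiv.swap s t with
    continuous_toFun := hc
    continuous_invFun := hc }

@[simp]
theorem swapHomeo_apply {L : Type*} [LinearOrder L] [TopologicalSpace L] [OrderTopology L]
    {s t : L} (hs : IsOpen {s}) (ht : IsOpen {t}) (x : L) :
    swapHomeo hs ht x = Equiv.swap s t x := rfl

/-- Successor ordinals are isolated. -/
theorem isOpen_singleton_add_one (o : Ordinal) : IsOpen {o + 1} :=
  SuccOrder.isOpen_singleton_iff.2 fun h => by
    simpa using (Order.isSuccPrelimit_iff_succ_ne.1 h.isSuccPrelimit) o

/-- A permutation of the ordinals fixing every ordinal from `M ≤ lam` on preserves the set of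
ordinals below `lam`. -/
theorem lt_iff_of_fixes_ge {M lam : Ordinal} (hM : M ≤ lam) {h : Ordinal ≃ Ordinal}
    (hh : ∀ x, M ≤ x → h x = x) (x : Ordinal) : x < lam ↔ h x < lam := by
  rcases lt_or_ge x M with hx | hx
  · refine iff_of_true (hx.trans_le hM) (lt_of_lt_of_le ?_ hM)
    by_contra! hle
    exact absurd (h.injective (hh _ hle)) (hx.trans_le hle).ne'
  · rw [hh x hx]

/-- The restriction to `Iio lam` of a homeomorphism of the ordinals which is the identity
from some `M ≤ lam` on. -/
def homeoIio {M lam : Ordinal} (hM : M ≤ lam) (h : Ordinal ≃ₜ Ordinal)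
    (hh : ∀ x, M ≤ x → h x = x) : Iio lam ≃ₜ Iio lam :=
  h.subtype (lt_iff_of_fixes_ge hM (h := h.toEquiv) hh)

@[simp]
theorem homeoIio_apply_coe {M lam : Ordinal} (hM : M ≤ lam) (h : Ordinal ≃ₜ Ordinal)
    (hh : ∀ x, M ≤ x → h x = x) (x : Iio lam) : (homeoIio hM h hh x : Ordinal) = h x := rfl

/-! ### Block transpositions and codes of pairs -/

/-- For `e < ω ^ d < K`, the transposition of the ordinals `ω ^ d + 1` and `ω ^ d + e + 2`. -/
noncomputable def blockPerm (K e d : Ordinal) : Equiv.Perm Ordinal :=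
  if e < ω ^ d ∧ ω ^ d < K then Equiv.swap (ω ^ d + 1) (ω ^ d + e + 1 + 1) else 1

theorem blockPerm_blockPerm (K e d x : Ordinal) : blockPerm K e d (blockPerm K e d x) = x := by
  unfold blockPerm
  split_ifs <;> simp

theorem blockPerm_moved {K e d x : Ordinal} (hx : blockPerm K e d x ≠ x) :
    e < ω ^ d ∧ ω ^ d < K ∧ (x = ω ^ d + 1 ∨ x = ω ^ d + e + 1 + 1) := by
  unfold blockPerm at hx
  split_ifs at hx with h
  · refine ⟨h.1, h.2, ?_⟩
    by_contra! h'
    exact hx (Equiv.swap_apply_of_ne_of_ne h'.1 h'.2)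
  · simp at hx

/-- Both swapped points stay in the block from ω ^ d to ω ^ (d + 1), as ω ^ (d + 1) is an additively
principal limit; so the swaps for different d are disjoint and glue along `log ω`. -/
theorem log_omega0_eq {d e x : Ordinal} (he : e < ω ^ d)
    (hx : x = ω ^ d + 1 ∨ x = ω ^ d + e + 1 + 1) : log ω x = d := by
  have hlt : ω ^ d < ω ^ (d + 1) := (opow_lt_opow_iff_right one_lt_omega0).2 (lt_add_one d)
  have hlim : Order.IsSuccLimit (ω ^ (d + 1)) :=
    isSuccLimit_opow_left isSuccLimit_omega0 (by simp)
  have h1 : ω ^ d ≤ x := by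
    rcases hx with rfl | rfl
    · exact le_self_add
    · rw [add_assoc, add_assoc]; exact le_self_add
  have h2 : x < ω ^ (d + 1) := by
    rcases hx with rfl | rfl
    · exact hlim.add_one_lt hlt
    · exact hlim.add_one_lt
        (hlim.add_one_lt (isPrincipal_add_omega0_opow _ hlt (he.trans hlt)))
  exact (log_eq_iff one_lt_omega0 (ne_bot_of_le_ne_bot (opow_pos d omega0_pos).ne' h1) d).2
    ⟨h1, h2⟩

theorem log_blockPerm (K e x : Ordinal) : log ω (blockPerm K e (log ω x) x) = log ω x := by
  by_cases hx : blockPerm K e (log ω x) x = x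
  · rw [hx]
  · have hx' : blockPerm K e (log ω x) (blockPerm K e (log ω x) x) ≠
        blockPerm K e (log ω x) x := fun h => hx ((blockPerm K e (log ω x)).injective h)
    obtain ⟨he, -, h⟩ := blockPerm_moved hx'
    exact log_omega0_eq he h

theorem continuous_blockPerm_log (K e : Ordinal) :
    Continuous fun x => blockPerm K e (log ω x) x := by
  refine continuous_of_finite_moved_of_monotone (q := log ω) (fun _ _ h => log_mono_right ω h)
    (log_blockPerm K e) (fun d => (Set.toFinite {ω ^ d + 1, ω ^ d + e + 1 + 1}).subset ?_) ?_
  · rintro y ⟨rfl, hy⟩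
    simpa using (blockPerm_moved hy).2.2
  · intro x hx
    rcases (blockPerm_moved hx).2.2 with h | h <;> rw [h] <;> exact isOpen_singleton_add_one _

/-- The homeomorphism of the ordinals which, for all `d` with `e < ω ^ d < K`, transposes
`ω ^ d + 1` and `ω ^ d + e + 2`. -/
noncomputable def blockHomeo (K e : Ordinal) : Ordinal ≃ₜ Ordinal where
  toFun x := blockPerm K e (log ω x) x
  invFun x := blockPerm K e (log ω x) x
  left_inv x := by
    simp only [log_blockPerm, blockPerm_blockPerm]
  right_inv x := by
    simp only [log_blockPerm, blockPerm_blockPerm]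
  continuous_toFun := continuous_blockPerm_log K e
  continuous_invFun := continuous_blockPerm_log K e

theorem blockHomeo_moved {κ : Cardinal} (hκ : Cardinal.aleph0 ≤ κ) {e x : Ordinal}
    (hx : blockHomeo κ.ord e x ≠ x) : e < x ∧ x < κ.ord := by
  obtain ⟨he, hK, h⟩ := blockPerm_moved hx
  have hlim := Cardinal.isSuccLimit_ord hκ
  rcases h with h | h <;> rw [h]
  · exact ⟨he.trans (lt_add_one _), hlim.add_one_lt hK⟩
  · refine ⟨he.trans_le ?_, hlim.add_one_lt (hlim.add_one_lt
      (isPrincipal_add_ord hκ hK (he.trans hK)))⟩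
    rw [add_assoc, add_assoc]; exact le_self_add

theorem blockHomeo_apply {K e d : Ordinal} (he : e < ω ^ d) (hK : ω ^ d < K) :
    blockHomeo K e (ω ^ d + 1) = ω ^ d + e + 1 + 1 := by
  change blockPerm K e (log ω (ω ^ d + 1)) (ω ^ d + 1) = _
  rw [log_omega0_eq he (Or.inl rfl), blockPerm, if_pos ⟨he, hK⟩, Equiv.swap_apply_left]

/-- Codes of pairs below d are small enough to be recorded in block d. -/
theorem opow_add_lt {a b d : Ordinal} (hab : a < b) (hb : b < d) : ω ^ b + a < ω ^ d := by
  have h : ω ^ b < ω ^ d := (opow_lt_opow_iff_right one_lt_omega0).2 hb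
  exact isPrincipal_add_omega0_opow _ h
    ((hab.trans_le (right_le_opow b one_lt_omega0)).trans h)

/-- The ordinal `ω ^ b + a` is a code for the pair of ordinals `a < b`. -/
theorem opow_add_injective {a b a' b' : Ordinal} (hab : a < b) (hab' : a' < b')
    (h : ω ^ b + a = ω ^ b' + a') : a = a' ∧ b = b' := by
  have hb : b = b' := by
    rcases lt_trichotomy b b' with hlt | heq | hlt
    · exact absurd h ((opow_add_lt hab hlt).trans_le le_self_add).ne
    · exact heq
    · exact absurd h ((opow_add_lt hab' hlt).trans_le le_self_add).ne'
  subst hb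
  exact ⟨add_left_cancel h, rfl⟩

/-! ### Closed sets in the two topologies -/

theorem stoneCechHomeo_stoneCechUnit {X : Type*} [TopologicalSpace X] (h : X ≃ₜ X) (x : X) :
    stoneCechHomeo h (stoneCechUnit x) = stoneCechUnit (h x) :=
  stoneCechExtend_stoneCechUnit (continuous_stoneCechUnit.comp h.continuous) x

theorem isClosed_range_homeoCptColimit {X ι : Type*} [TopologicalSpace X] (f : ι → HomeoCpt X)
    (hf : ∀ K : Set X, IsCompact K →
      IsClosed[homeoSuppCompactOpen X K] {h | ∃ i, h.1 = (f i).1}) :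
    IsClosed[homeoCptColimit X] (range f) := by
  simp only [isClosed_iSup_iff, isClosed_coinduced]
  intro K hK
  convert hf K hK using 1
  ext h
  exact exists_congr fun i => ⟨fun e => congrArg Subtype.val e.symm, fun e => Subtype.ext e.symm⟩

/-- If the members of a family of compactly supported homeomorphisms are not the identity, but
move points of `X` by arbitrarily small amounts, uniformly in the points and measured in `βX`,
then they do not form a closed set in the topology induced by `Homeo(βX)`. -/
theorem not_isClosed_range_homeoCptBeta {X ι : Type*} [TopologicalSpace X] (f : ι → HomeoCpt X)
    (hne : ∀ i, (f i).1 ≠ Homeomorph.refl X)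
    (hconv : ∀ V ∈ @uniformity (StoneCech X) uniformSpaceOfCompactR1, ∃ i, ∀ x,
      (stoneCechUnit x, stoneCechUnit ((f i).1 x)) ∈ V) :
    ¬ IsClosed[homeoCptBeta X] (range f) := by
  let : UniformSpace (StoneCech X) := uniformSpaceOfCompactR1
  intro hcl
  obtain ⟨C, hC, hCf⟩ := (@isClosed_induced_iff _ _ (homeoCompactOpen (StoneCech X)) _ _).1 hcl
  obtain ⟨D, hD, rfl⟩ := isClosed_induced_iff.1 hC
  let one : HomeoCpt X := ⟨Homeomorph.refl X, ∅, isCompact_empty, fun _ _ => rfl⟩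
  have hmem : one ∈ range f := by
    rw [← hCf]
    change (_ : C(StoneCech X, StoneCech X)) ∈ D
    -- Closed entourages let the estimate pass from the dense image of X to all of βX.
    rw [← hD.closure_eq, mem_closure_iff_nhds_basis (nhds_basis_uniformity'
      (uniformity_hasBasis_closed.compactConvergenceUniformity_of_compact))]
    rintro V ⟨hV, hVc⟩
    obtain ⟨i, hi⟩ := hconv V hV
    have hiD : f i ∈ range f := mem_range_self i
    rw [← hCf] at hiD
    refine ⟨_, hiD, fun z => ?_⟩
    have hone : ∀ w, stoneCechHomeo one.1 w = w := by
      refine congrFun (stoneCech_hom_ext (stoneCechHomeo one.1).continuous continuous_id ?_)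
      ext x
      exact stoneCechHomeo_stoneCechUnit one.1 x
    change (stoneCechHomeo one.1 z, stoneCechHomeo (f i).1 z) ∈ V
    rw [hone]
    refine denseRange_stoneCechUnit.induction_on
      (p := fun z => (z, stoneCechHomeo (f i).1 z) ∈ V) z
      (hVc.preimage (continuous_id.prodMk (stoneCechHomeo (f i).1).continuous)) fun x => ?_
    rw [stoneCechHomeo_stoneCechUnit]
    exact hi x
  obtain ⟨i, hi⟩ := hmem
  exact hne i (congrArg Subtype.val hi)

theorem not_hasCSHP {X ι : Type*} [TopologicalSpace X] (f : ι → HomeoCpt X)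
    (hf : ∀ K : Set X, IsCompact K →
      IsClosed[homeoSuppCompactOpen X K] {h | ∃ i, h.1 = (f i).1})
    (hne : ∀ i, (f i).1 ≠ Homeomorph.refl X)
    (hconv : ∀ V ∈ @uniformity (StoneCech X) uniformSpaceOfCompactR1, ∃ i, ∀ x,
      (stoneCechUnit x, stoneCechUnit ((f i).1 x)) ∈ V) :
    ¬ HasCSHP X := fun h =>
  not_isClosed_range_homeoCptBeta f hne hconv (h ▸ isClosed_range_homeoCptColimit f hf)

theorem continuous_homeoSupp_eval {X : Type*} [TopologicalSpace X] (K : Set X) (x : X) :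
    Continuous[homeoSuppCompactOpen X K, _] fun h : HomeoSupp X K => h.1 x := by
  let := homeoCompactOpen X
  have h1 : Continuous fun h : X ≃ₜ X => (⟨h, h.continuous⟩ : C(X, X)) := continuous_induced_dom
  have h2 : Continuous fun h : HomeoSupp X K => (⟨h.1, h.1.continuous⟩ : C(X, X)) :=
    h1.comp continuous_subtype_val
  exact (continuous_eval_const (F := C(X, X)) x).comp h2

theorem t1Space_homeoSupp {X : Type*} [TopologicalSpace X] [T1Space X] (K : Set X) :
    @T1Space (HomeoSupp X K) (homeoSuppCompactOpen X K) := by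
  let := homeoSuppCompactOpen X K
  refine ⟨fun g => ?_⟩
  have : ({g} : Set (HomeoSupp X K)) = ⋂ x, {h | h.1 x = g.1 x} := by
    ext h
    simp only [mem_singleton_iff, mem_iInter, mem_ofPred_eq]
    exact ⟨fun e _ => e ▸ rfl, fun e => Subtype.ext (Homeomorph.ext e)⟩
  rw [this]
  exact isClosed_iInter fun x => isClosed_singleton.preimage (continuous_homeoSupp_eval K x)

/-- A set of homeomorphisms which are distinguished by their values at an isolated point is
closed. -/
theorem isClosed_homeoSupp_of_injOn {X : Type*} [TopologicalSpace X] [T1Space X] (K : Set X)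
    {p : X} (hp : IsOpen {p}) {A : Set (HomeoSupp X K)} (hA : A.InjOn fun h => h.1 p) :
    IsClosed[homeoSuppCompactOpen X K] A := by
  let := homeoSuppCompactOpen X K
  have := t1Space_homeoSupp K
  refine isClosed_of_closure_subset fun g hg => ?_
  -- As g maps the isolated point p to an isolated point, agreeing with g at p is an open condition,
  -- and at most one member of A satisfies it.
  have hgo : IsOpen {h : HomeoSupp X K | h.1 p = g.1 p} := by
    have : IsOpen {g.1 p} := by
      simpa using g.1.isOpenMap _ hp
    exact this.preimage (continuous_homeoSupp_eval K p)
  have h1 : g ∈ closure ({h : HomeoSupp X K | h.1 p = g.1 p} ∩ A) :=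
    hgo.inter_closure ⟨rfl, hg⟩
  have hsub : ({h : HomeoSupp X K | h.1 p = g.1 p} ∩ A).Subsingleton :=
    fun a ha b hb => hA ha.2 hb.2 (ha.1.trans hb.1.symm)
  rw [hsub.isClosed.closure_eq] at h1
  exact h1.2

/-! ### The family of swaps indexed by pairs -/

theorem isCompact_Iic_Iio {lam : Ordinal} (b : Iio lam) : IsCompact (Iic b) := by
  rw [Subtype.isCompact_iff]
  have : Subtype.val '' Iic b = Icc 0 b.1 := by
    ext x
    constructor
    · rintro ⟨y, hy, rfl⟩
      exact ⟨zero_le, hy⟩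
    · exact fun hx => ⟨⟨x, hx.2.trans_lt b.2⟩, hx.2, rfl⟩
  rw [this]
  exact isCompact_Icc

/-- Let `c` be a strictly increasing cofinal `K`-sequence in `lam`. For `a < b < K`, compose the
transposition of `c a + 1` and `c b + 1` with a homeomorphism `low a b` moving only ordinals below
`M < lam`. If `low a b` tends to the identity, and for each `d < K` the maps `low a b` with
`a < b < d` are either finitely many or distinguished by their values at an isolated point, then
these compositions show that `lam` does not have CSHP. -/
theorem not_hasCSHP_of_isCofinal {lam K M : Ordinal} (hlam : Order.IsSuccLimit lam)
    (hK : Order.IsSuccLimit K) (hM : M < lam) {c : Iio K → Iio lam} (hc : StrictMono c)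
    (hcof : IsCofinal (range c)) (low : Ordinal → Ordinal → (Ordinal ≃ₜ Ordinal))
    (hlow : ∀ a b x, M ≤ x → low a b x = x)
    (hsmall : ∀ V ∈ @uniformity (StoneCech (Iio lam)) uniformSpaceOfCompactR1,
      ∃ a₀ < K, ∀ a b, a₀ ≤ a → a < b → b < K → ∀ x : Iio lam,
        (stoneCechUnit x, stoneCechUnit (homeoIio hM.le (low a b) (hlow a b) x)) ∈ V)
    (hsep : ∀ d < K, (Iio d).Finite ∨ ∃ p < M, IsOpen {p} ∧
      {ab : Ordinal × Ordinal | ab.1 < ab.2 ∧ ab.2 < d}.InjOn fun ab => low ab.1 ab.2 p) :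
    ¬ HasCSHP (Iio lam) := by
  -- Requiring M ≤ c a puts the swapped points above M, so the swap and `low a b` have disjoint
  -- supports.
  let ι := {ab : Iio K × Iio K // ab.1 < ab.2 ∧ M ≤ (c ab.1).1}
  let s : Iio K → Ordinal := fun a => (c a).1 + 1
  have hs_lt : ∀ a, s a < lam := fun a => hlam.add_one_lt (c a).2
  have hs_mono : StrictMono s := fun a b hab => by
    have : (c a).1 < (c b).1 := hc hab
    simpa [s] using this
  have hlow_lt : ∀ a b x, x < M → low a b x < M := fun a b x hx =>
    (lt_iff_of_fixes_ge le_rfl (h := (low a b).toEquiv) (hlow a b) x).1 hx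
  let F : ι → Ordinal ≃ₜ Ordinal := fun i =>
    (low i.1.1 i.1.2).trans
      (swapHomeo (isOpen_singleton_add_one (c i.1.1).1) (isOpen_singleton_add_one (c i.1.2).1))
  have hF : ∀ (i : ι) x, F i x = Equiv.swap (s i.1.1) (s i.1.2) (low i.1.1 i.1.2 x) :=
    fun _ _ => rfl
  have hMs : ∀ i : ι, M < s i.1.1 := fun i => i.2.2.trans_lt (lt_add_one _)
  have hss : ∀ i : ι, s i.1.1 < s i.1.2 := fun i => hs_mono i.2.1
  have hF_lt : ∀ (i : ι) x, x < M → F i x = low i.1.1 i.1.2 x := fun i x hx => by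
    have h1 := (hlow_lt i.1.1 i.1.2 x hx).trans (hMs i)
    rw [hF, Equiv.swap_apply_of_ne_of_ne h1.ne (h1.trans (hss i)).ne]
  have hF_ge : ∀ (i : ι) x, M ≤ x → F i x = Equiv.swap (s i.1.1) (s i.1.2) x :=
    fun i x hx => by rw [hF, hlow _ _ x hx]
  have hF_fix : ∀ (i : ι) x, s i.1.2 < x → F i x = x := fun i x hx => by
    rw [hF_ge i x (((hMs i).trans (hss i)).trans hx).le,
      Equiv.swap_apply_of_ne_of_ne ((hss i).trans hx).ne' hx.ne']
  have hF_fix' : ∀ (i : ι) x, s i.1.2 + 1 ≤ x → F i x = x := fun i x hx =>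
    hF_fix i x ((lt_add_one _).trans_le hx)
  have hs1 : ∀ a, s a + 1 ≤ lam := fun a => (hlam.add_one_lt (hs_lt a)).le
  let f : ι → HomeoCpt (Iio lam) := fun i =>
    ⟨homeoIio (hs1 i.1.2) (F i) (hF_fix' i), Iic ⟨s i.1.2, hs_lt _⟩, isCompact_Iic_Iio _,
      fun x hx => Subtype.ext (hF_fix i x (not_le.1 hx))⟩
  have hfF : ∀ i x, ((f i).1 x : Ordinal) = F i x := fun _ _ => rfl
  have hf_moved : ∀ i, (f i).1 ⟨s i.1.2, hs_lt _⟩ ≠ ⟨s i.1.2, hs_lt _⟩ := fun i h => by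
    have h' : F i (s i.1.2) = s i.1.2 := congrArg Subtype.val h
    rw [hF_ge i _ ((hMs i).trans (hss i)).le, Equiv.swap_apply_right] at h'
    exact (hss i).ne h'
  refine not_hasCSHP f (fun C hC => ?_) (fun i h => hf_moved i (h ▸ rfl)) fun V hV => ?_
  -- C is bounded by some c d and must contain the moved point c b + 1, hence b < d.
  · obtain ⟨d, hdK, hd⟩ : ∃ d < K, ∀ i : ι, (∀ x ∉ C, (f i).1 x = x) → i.1.2 < d := by
      have : Nonempty (Iio lam) := ⟨⟨M, hM⟩⟩
      obtain ⟨b, hb⟩ := hC.bddAbove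
      obtain ⟨_, ⟨d, rfl⟩, hd⟩ := hcof b
      refine ⟨d, d.2, fun i hi => ?_⟩
      have hmem : (⟨s i.1.2, hs_lt _⟩ : Iio lam) ∈ C := by
        by_contra h
        exact hf_moved i (hi _ h)
      have h1 : s i.1.2 ≤ (c d).1 := (show (⟨s i.1.2, hs_lt _⟩ : Iio lam) ≤ c d from
        (hb hmem).trans hd)
      have h2 : c i.1.2 < c d := (lt_add_one (c i.1.2).1).trans_le h1
      exact hc.lt_iff_lt.1 h2
    rcases hsep d hdK with hfin | ⟨p, hpM, hp, hinj⟩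
    · let := homeoSuppCompactOpen (Iio lam) C
      have := t1Space_homeoSupp (X := Iio lam) C
      have hfin' : {i : ι | (i.1.2 : Ordinal) < d}.Finite := by
        refine Set.Finite.of_finite_image ((hfin.prod hfin).subset ?_)
          (f := fun i : ι => ((i.1.1 : Ordinal), (i.1.2 : Ordinal))) ?_
        · rintro _ ⟨i, hi, rfl⟩
          exact ⟨(show (i.1.1 : Ordinal) < i.1.2 from i.2.1).trans hi, hi⟩
        · rintro i - j - h
          simp only [Prod.mk.injEq] at h
          exact Subtype.ext (Prod.ext (Subtype.ext h.1) (Subtype.ext h.2))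
      refine Set.Finite.isClosed (Set.Finite.of_finite_image
        ((hfin'.image fun i => (f i).1).subset ?_) Subtype.val_injective.injOn)
      rintro _ ⟨h, ⟨i, hi⟩, rfl⟩
      exact ⟨i, hd i (fun x hx => hi ▸ h.2 x hx), hi.symm⟩
    · have hpl : p < lam := hpM.trans hM
      refine isClosed_homeoSupp_of_injOn C (p := ⟨p, hpl⟩) ?_ ?_
      · convert hp.preimage (continuous_subtype_val (p := (· ∈ Iio lam))) using 1
        ext x
        simp [Subtype.ext_iff]
      · rintro g ⟨i, hi⟩ g' ⟨j, hj⟩ hgg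
        have e : F i p = F j p := by
          have := congrArg Subtype.val hgg
          simp only [hi, hj, hfF] at this
          exact this
        rw [hF_lt i p hpM, hF_lt j p hpM] at e
        have hi2 : (i.1.2 : Ordinal) < d := hd i fun x hx => hi ▸ g.2 x hx
        have hj2 : (j.1.2 : Ordinal) < d := hd j fun x hx => hj ▸ g'.2 x hx
        have := hinj (x₁ := ((i.1.1 : Ordinal), (i.1.2 : Ordinal)))
          (x₂ := ((j.1.1 : Ordinal), (j.1.2 : Ordinal))) ⟨i.2.1, hi2⟩ ⟨j.2.1, hj2⟩ e
        simp only [Prod.mk.injEq] at this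
        have hij : i = j := Subtype.ext (Prod.ext (Subtype.ext this.1) (Subtype.ext this.2))
        exact Subtype.ext (hi.trans (hij ▸ hj.symm))
  · let : UniformSpace (StoneCech (Iio lam)) := uniformSpaceOfCompactR1
    obtain ⟨W, hW, hWs, hWV⟩ := comp_symm_mem_uniformity_sets hV
    obtain ⟨a₀, ha₀, hsm⟩ := hsmall V hV
    -- Finitely many W-balls cover βX, so two of the infinitely many points c a + 1 with large a
    -- share a ball centre.
    obtain ⟨t, ht, hcov⟩ :=
      (isCompact_univ (X := StoneCech (Iio lam))).totallyBounded W hW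
    obtain ⟨_, ⟨a₁, rfl⟩, ha₁⟩ := hcof ⟨M, hM⟩
    let u : Iio K → StoneCech (Iio lam) := fun a => stoneCechUnit ⟨s a, hs_lt a⟩
    have : NoMaxOrder (Iio K) := ⟨fun a => ⟨⟨a.1 + 1, hK.add_one_lt a.2⟩, lt_add_one a.1⟩⟩
    have hinf : (Ici (max ⟨a₀, ha₀⟩ a₁) : Set (Iio K)).Infinite := Set.Ici_infinite _
    have hcov' : ∀ a, ∃ y ∈ t, (u a, y) ∈ W := fun a => by
      simpa using hcov (mem_univ (u a))
    choose y hyt hyW using hcov'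
    have hclose : ∀ {a b}, y a = y b → (u a, u b) ∈ V := fun {a b} h =>
      hWV ⟨y a, hyW a, h ▸ hWs.symm _ _ (hyW b)⟩
    obtain ⟨a, ha, b, hb, hab, hyab⟩ : ∃ a ∈ Ici (max ⟨a₀, ha₀⟩ a₁), ∃ b ∈ Ici (max ⟨a₀, ha₀⟩ a₁),
        a < b ∧ y a = y b := by
      obtain ⟨a, ha, b, hb, hab, h⟩ := hinf.exists_ne_map_eq_of_mapsTo (fun a _ => hyt a) ht
      rcases hab.lt_or_gt with h' | h'
      · exact ⟨a, ha, b, hb, h', h⟩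
      · exact ⟨b, hb, a, ha, h', h.symm⟩
    have haa₁ : a₁ ≤ a := (le_max_right _ _).trans ha
    have haa₀ : a₀ ≤ a := (le_max_left (⟨a₀, ha₀⟩ : Iio K) a₁).trans ha
    let i : ι := ⟨(a, b), hab, (show M ≤ (c a₁).1 from ha₁).trans (hc.monotone haa₁)⟩
    refine ⟨i, fun x => ?_⟩
    rcases lt_or_ge x.1 M with hx | hx
    · have : (f i).1 x = homeoIio hM.le (low a b) (hlow a b) x := Subtype.ext (hF_lt i x hx)
      rw [this]
      exact hsm a b haa₀ hab b.2 x
    · have hFx := hF_ge i x hx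
      by_cases hxa : x.1 = s a
      · have h1 : x = ⟨s a, hs_lt a⟩ := Subtype.ext hxa
        have h2 : (f i).1 x = ⟨s b, hs_lt b⟩ :=
          Subtype.ext (hFx.trans (hxa ▸ Equiv.swap_apply_left _ _))
        rw [h2, h1]
        exact hclose hyab
      by_cases hxb : x.1 = s b
      · have h1 : x = ⟨s b, hs_lt b⟩ := Subtype.ext hxb
        have h2 : (f i).1 x = ⟨s a, hs_lt a⟩ :=
          Subtype.ext (hFx.trans (hxb ▸ Equiv.swap_apply_right _ _))
        rw [h2, h1]
        exact hclose hyab.symm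
      · have h2 : (f i).1 x = x :=
          Subtype.ext (hFx.trans (Equiv.swap_apply_of_ne_of_ne hxa hxb))
        rw [h2]
        exact refl_mem_uniformity hV

/-! ### Countable cofinality and singular `lam` -/

theorem not_hasCSHP_of_cof_eq_aleph0 {lam : Ordinal} (hlam : Order.IsSuccLimit lam)
    (h : lam.cof = Cardinal.aleph0) : ¬ HasCSHP (Iio lam) := by
  obtain ⟨c, hc⟩ := exists_isFundamentalSeq (o := lam) (a := ω) (by rw [h, Cardinal.ord_aleph0])
  refine not_hasCSHP_of_isCofinal hlam isSuccLimit_omega0 hlam.bot_lt hc.strictMono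
    hc.isCofinal_range (fun _ _ => Homeomorph.refl _) (fun _ _ _ _ => rfl) (fun V hV => ?_)
    fun d hd => Or.inl ?_
  · let : UniformSpace (StoneCech (Iio lam)) := uniformSpaceOfCompactR1
    exact ⟨0, omega0_pos, fun _ _ _ _ _ _ => refl_mem_uniformity hV⟩
  · obtain ⟨n, rfl⟩ := lt_omega0.1 hd
    refine ((Set.finite_Iio n).image (Nat.cast : ℕ → Ordinal)).subset fun x hx => ?_
    obtain ⟨m, rfl⟩ := lt_omega0.1 (hx.trans hd)
    exact ⟨m, Nat.cast_lt.1 (mem_Iio.1 hx), rfl⟩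

theorem not_hasCSHP_of_ord_cof_lt {lam : Ordinal} (hlam : Order.IsSuccLimit lam)
    (h : Cardinal.aleph0 < lam.cof) (hlt : lam.cof.ord < lam) : ¬ HasCSHP (Iio lam) := by
  obtain ⟨c, hc⟩ := exists_isFundamentalSeq (o := lam) rfl
  have hlim : Order.IsSuccLimit lam.cof.ord := Cardinal.isSuccLimit_ord h.le
  have hω : ω < lam.cof.ord := by rwa [← Cardinal.ord_aleph0, Cardinal.ord_lt_ord]
  have hlow : ∀ a b x : Ordinal, lam.cof.ord ≤ x → blockHomeo lam.cof.ord (ω ^ b + a) x = x :=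
    fun a b x hx => by_contra fun hne => (blockHomeo_moved h.le hne).2.not_ge hx
  refine not_hasCSHP_of_isCofinal hlam hlim hlt hc.strictMono hc.isCofinal_range
    (fun a b => blockHomeo lam.cof.ord (ω ^ b + a)) hlow (fun V hV => ?_) fun d hd => Or.inr ?_
  · let : UniformSpace (StoneCech (Iio lam)) := uniformSpaceOfCompactR1
    obtain ⟨W, hW, hWs, hWV⟩ := comp_symm_mem_uniformity_sets hV
    -- Here κ < `lam` matters: κ is a point of the space, and all moved points lie in a small
    -- interval just below it.
    let k : Iio lam := ⟨lam.cof.ord, hlt⟩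
    have hnhds : {x : Iio lam | (stoneCechUnit x, stoneCechUnit k) ∈ W} ∈ 𝓝 k :=
      continuous_stoneCechUnit.continuousAt (mem_nhds_right _ hW)
    obtain ⟨a₀, ha₀, hsub⟩ := exists_Ioc_subset_of_mem_nhds hnhds
      ⟨⟨0, hlam.bot_lt⟩, hlim.bot_lt⟩
    refine ⟨a₀, ha₀, fun a b ha hab hb x => ?_⟩
    have hmem : ∀ y : Iio lam, blockHomeo lam.cof.ord (ω ^ b + a) y ≠ y →
        (stoneCechUnit y, stoneCechUnit k) ∈ W := fun y hy => by
      obtain ⟨h1, h2⟩ := blockHomeo_moved h.le hy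
      exact hsub ⟨(ha.trans le_add_self).trans_lt h1, h2.le⟩
    by_cases hx : homeoIio hlt.le _ (hlow a b) x = x
    · rw [hx]
      exact refl_mem_uniformity hV
    · refine hWV ⟨_, hmem x fun e => hx (Subtype.ext e), hWs.symm _ _ (hmem _ fun e => hx ?_)⟩
      exact Subtype.ext ((blockHomeo lam.cof.ord (ω ^ b + a)).injective e)
  -- An uncountable initial ordinal is closed under exponentiation, so block d lies below κ and its
  -- point ω ^ d + 1 reads off every code with b < d.
  · have hd' : ω ^ d < lam.cof.ord := isPrincipal_opow_ord h.le hω hd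
    refine ⟨ω ^ d + 1, hlim.add_one_lt hd', isOpen_singleton_add_one _, ?_⟩
    rintro ⟨a, b⟩ ⟨hab, hb⟩ ⟨a', b'⟩ ⟨hab', hb'⟩ e
    simp only [blockHomeo_apply (opow_add_lt hab hb) hd',
      blockHomeo_apply (opow_add_lt hab' hb') hd'] at e
    have e' : ω ^ b + a = ω ^ b' + a' := by simpa using e
    obtain ⟨rfl, rfl⟩ := opow_add_injective hab hab' e'
    rfl

theorem mainTheorem5 (lam : Ordinal) (hlam : Order.IsSuccLimit lam)
    (h : HasCSHP (Set.Iio lam)) :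
    ∃ κ : Cardinal, Cardinal.aleph0 < κ ∧ κ.IsRegular ∧ lam = κ.ord := by
  have hreg := Cardinal.isRegular_cof hlam
  have hunc : Cardinal.aleph0 < lam.cof := lt_of_le_of_ne hreg.aleph0_le fun he =>
    not_hasCSHP_of_cof_eq_aleph0 hlam he.symm h
  refine ⟨lam.cof, hunc, hreg, ?_⟩
  by_contra hne
  exact not_hasCSHP_of_ord_cof_lt hlam hunc (lt_of_le_of_ne (ord_cof_le lam) (Ne.symm hne)) h
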